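/- An arc-parameterized digraph $D_\Lambda=(V,A,\Lambda)$ is a finite directed multigraph $D=(V,A)$ (loops and parallel arcs allowed, not necessarily connected) with arc parameters $\lambda_a\ge 0$, where $\lambda_a=0$ only if $a$ is a loop. Its generalized network matrix $N_\Lambda\in\mathbb{R}^{V\times A}$ has the column $e_j-\lambda_a e_i$ for every arc $a=(i,j)$. Put $$\mathcal F(D_\Lambda)=\ker N_\Lambda,\qquad \mathcal B(D_\Lambda)=\operatorname{Im} N_\Lambda^{\top}$$ (generalized flows and generalized bonds), and let $\mathcal F(D_\Lambda)_{\le c}$ and $\mathcal B(D_\Lambda)_{\le c}$ be their subsets of vectors that are componentwise at most $c\in\mathbb{R}^A$. Let $P(D_\Lambda)_{\le c}=\{p\in\mathbb{R}^V\mid N_\Lambda^\top p\le c\}$. The digraph $D_\Lambda$ is breakeven if every cycle $C$ of the underlying undirected graph (a loop being a cycle of length one), with a cyclic orientation, satisfies $\prod_{a\in C^+}\lambda_a\prod_{a\in C^-}\lambda_a^{-1}=1$, where $C^+$ and $C^-$ are the sets of forward and backward arcs of $C$. A D-polyhedron is a polyhedron in $\mathbb{R}^n$ that is closed under componentwise maximum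 and minimum. Let $D_\Lambda$ be a planar breakeven digraph with a non-crossing embedding of $D$ in the sphere, and let $D^*$ be the dual digraph: its vertices are the faces, and the dual of an arc $a$ goes from the face to the left of $a$ to the face to the right of $a$. Then there are an arc parameterization $\Lambda^*$ of $D^*$ and a vector $\sigma\in\mathbb{R}^A$ with positive components such that, with $S(\sigma)=\operatorname{diag}(\sigma)$, $$f\in\mathcal F(D_\Lambda)\iff S(\sigma)f\in\mathcal B(D^*_{\Lambda^*})\qquad\text{for all } f\in\mathbb{R}^A ,$$ and for every capacity vector $c\in\mathbb{R}^A$ the set $\mathcal F(D_\Lambda)_{\le c}$ carries the structure of a distributive lattice, obtained from the lattice on the generalized bonds of the dual as follows. There is a D-polyhedron $P'$, the intersection of $P(D^*_{\Lambda^*})_{\le S(\sigma)c}$ with some hyperplanes of the form $\{p\mid p_i=0\}$, and there are distributive lattice structures on $\mathcal B(D^*_{\Lambda^*})_{\le S(\sigma)c}$ and on $\mathcal F(D_\Lambda)_{\le c}$, such that $p\mapsto N_{\Lambda^*}^\top p$ is a lattice isomorphism from $P'$, with componentwise maximum and minimum, onto $\mathcal B(D^*_{\Lambda^*})_{\le S(\sigma)c}$,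 and $f\mapsto S(\sigma)f$ is a lattice isomorphism from $\mathcal F(D_\Lambda)_{\le c}$ onto $\mathcal B(D^*_{\Lambda^*})_{\le S(\sigma)c}$. -/

import Mathlib

open Matrix

/-- A directed multigraph (loops and parallel arcs allowed) with vertex type `V` and
arc type `A`. -/
structure MultiDigraph (V A : Type*) where
  /-- initial vertex of an arc -/
  tail : A → V
  /-- terminal vertex of an arc -/
  head : A → V

namespace MultiDigraph

variable {V A : Type*} (D : MultiDigraph V A)

/-- Starting vertex of a dart: `(a, true)` is the arc `a` traversed forward, from tail to head,
and `(a, false)` is the arc `a` traversed backward. -/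
def src (d : A × Bool) : V := if d.2 then D.tail d.1 else D.head d.1

/-- End vertex of a dart. -/
def tgt (d : A × Bool) : V := if d.2 then D.head d.1 else D.tail d.1

/-- A list of darts is a walk from `u` to `v` in the underlying undirected graph. -/
def IsWalk : V → V → List (A × Bool) → Prop
  | u, v, [] => u = v
  | u, v, d :: w => D.src d = u ∧ IsWalk (D.tgt d) v w

/-- A cycle of the underlying undirected graph together with a cyclic orientation (and a
starting point): a nonempty closed walk repeating no vertex and no arc. A loop is a cycle of
length one, two parallel or antiparallel arcs form a cycle of length two. -/
def IsCycle (w : List (A × Bool)) : Prop :=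
  w ≠ [] ∧ (∃ v, D.IsWalk v v w) ∧ (w.map D.src).Nodup ∧ (w.map Prod.fst).Nodup

/-- The type of connected components of the underlying undirected graph. -/
def Component : Type _ := Quot (fun u v : V => ∃ a, D.tail a = u ∧ D.head a = v)

/-- A vertex that is on no arc. -/
def IsIsolated (v : V) : Prop := ∀ a, D.tail a ≠ v ∧ D.head a ≠ v

end MultiDigraph

/-- The same arc traversed in the other direction. -/
def oppDart {A : Type*} (d : A × Bool) : A × Bool := (d.1, !d.2)

/-- A non-crossing embedding of a finite directed multigraph in the oriented sphere, up to
homeomorphism, in combinatorial form; `F` is the set of faces (the components of the complement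
of the drawing). The graph may be disconnected, so a face may have several boundary walks. -/
structure SphereEmbedding {V A : Type*} [Fintype V] [Fintype A]
    (D : MultiDigraph V A) (F : Type*) [Fintype F] where
  /-- the next dart in counterclockwise order around the starting vertex of a dart -/
  rot : Equiv.Perm (A × Bool)
  src_rot : ∀ d, D.src (rot d) = D.src d
  rot_sameCycle : ∀ d d', D.src d = D.src d' → rot.SameCycle d d'
  /-- the face on the right-hand side of a dart -/
  face : A × Bool → F
  /-- Upon arrival at the end of `d`, the next dart on the boundary walk that has its face on
  the right is the counterclockwise successor of the reverse of `d`; thus the orbits of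
  `d ↦ rot (oppDart d)` are the clockwise facial walks. -/
  face_next : ∀ d, face (rot (oppDart d)) = face d
  /-- the face in which an isolated vertex lies -/
  home : {v : V // D.IsIsolated v} → F
  /-- The vertex-face incidence graph is connected (the sphere is connected). -/
  connected : ∀ x y : V ⊕ F, Relation.EqvGen (fun x y =>
      (∃ d, x = Sum.inl (D.src d) ∧ y = Sum.inr (face d)) ∨
      (∃ v, x = Sum.inl v.1 ∧ y = Sum.inr (home v))) x y
  /-- Euler's formula for the sphere: `|V| - |A| + |F| = 1 + (number of components)`. -/
  euler : Fintype.card V + Fintype.card F = Fintype.card A + 1 + Nat.card D.Component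

/-- The dual digraph, on the faces and with the same arc set: the dual of `a` goes from `v` to `w`
if `a` is a backward arc of the clockwise facial walk of `v` and a forward arc of the clockwise
facial walk of `w`, that is, if `v` is to the left and `w` to the right of `a`. -/
def SphereEmbedding.dual {V A F : Type*} [Fintype V] [Fintype A] [Fintype F]
    {D : MultiDigraph V A} (E : SphereEmbedding D F) : MultiDigraph F A where
  tail a := E.face (a, false)
  head a := E.face (a, true)

/-- An arc-parameterized digraph: nonnegative arc parameters, zero only on loops. -/
structure ArcParamDigraph (V A : Type*) extends MultiDigraph V A where
  lam : A → ℝ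
  lam_nonneg : ∀ a, 0 ≤ lam a
  loop_of_lam_eq_zero : ∀ a, lam a = 0 → tail a = head a

namespace ArcParamDigraph

variable {V A : Type*} (D : ArcParamDigraph V A)

/-- The multiplier of an oriented arc set listed as darts: the product of `λ_a ^ (± 1)`. -/
noncomputable def multiplier (w : List (A × Bool)) : ℝ :=
  (w.map fun d => if d.2 then D.lam d.1 else (D.lam d.1)⁻¹).prod

/-- All cycles of the underlying graph are breakeven. -/
def Breakeven : Prop := ∀ w, D.IsCycle w → D.multiplier w = 1

open Classical in
/-- The generalized network matrix, with column `e_j - λ_a e_i` for the arc `a = (i, j)`. -/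
noncomputable def networkMatrix : Matrix V A ℝ :=
  fun v a => (if v = D.head a then 1 else 0) - D.lam a * (if v = D.tail a then 1 else 0)

/-- Generalized flows: the elements of the kernel of the generalized network matrix. -/
def IsFlow [Fintype A] (f : A → ℝ) : Prop := D.networkMatrix *ᵥ f = 0

/-- Generalized bonds: the elements of the image of the transposed generalized network matrix. -/
def IsBond [Fintype V] (x : A → ℝ) : Prop := ∃ p : V → ℝ, D.networkMatrixᵀ *ᵥ p = x

/-- The set of generalized flows `f ≤ c` (as a bare type, without the componentwise order). -/
def BoundedFlow [Fintype A] (c : A → ℝ) : Type _ := {f : A → ℝ // D.IsFlow f ∧ f ≤ c}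

/-- The set of generalized bonds `x ≤ c` (as a bare type, without the componentwise order). -/
def BoundedBond [Fintype V] (c : A → ℝ) : Type _ := {x : A → ℝ // D.IsBond x ∧ x ≤ c}

/-- The polyhedron of feasible potentials. -/
def potentials [Fintype V] (c : A → ℝ) : Set (V → ℝ) := {p | D.networkMatrixᵀ *ᵥ p ≤ c}

end ArcParamDigraph

/-- A distributive polyhedron: a finite intersection of closed halfspaces of `ℝ^V` that is closed
under componentwise maximum and minimum. -/
def IsDPolyhedron {V : Type*} [Fintype V] (P : Set (V → ℝ)) : Prop :=
  (∃ (k : ℕ) (M : Matrix (Fin k) V ℝ) (b : Fin k → ℝ), P = {p | M *ᵥ p ≤ b}) ∧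
    SupClosed P ∧ InfClosed P

/-! In a breakeven digraph the multiplier of a walk depends only on its ends, so the parameters are
quotients of a positive vertex function `π`: `λ_a = π (head a) / π (tail a)`
(`Breakeven.exists_vertex_scaling`). Scaling row `v` by `π v` and column `a` by `(π (head a))⁻¹`
turns the network matrix into the ordinary one. Thus `f` is a generalized flow iff `σ * f` is a
circulation, with `σ a = π (head a)`, and all dual parameters can be taken to be 1.

Circulations of a plane digraph are the bonds of its dual (`range_dual_eq_ker`): one inclusion
telescopes around each vertex, and Euler's formula matches the dimensions. As the dual is connected,
fixing the potential of one face to be 0 makes bonds correspond to potentials. The feasible ones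
form a D-polyhedron, whose lattice is carried over to bonds and then to flows. -/

namespace MultiDigraph

/-! ### Walks and paths -/

variable {V A : Type*} {D : MultiDigraph V A}

@[simp] theorem src_oppDart (d : A × Bool) : D.src (oppDart d) = D.tgt d := by
  rcases d with ⟨a, _ | _⟩ <;> simp [src, tgt, oppDart]

@[simp] theorem tgt_oppDart (d : A × Bool) : D.tgt (oppDart d) = D.src d := by
  rcases d with ⟨a, _ | _⟩ <;> simp [src, tgt, oppDart]

theorem isWalk_append {u v : V} {l₁ l₂ : List (A × Bool)} :
    D.IsWalk u v (l₁ ++ l₂) ↔ ∃ x, D.IsWalk u x l₁ ∧ D.IsWalk x v l₂ := by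
  induction l₁ generalizing u with
  | nil => simp [IsWalk]
  | cons d l ih => simp [IsWalk, ih, and_assoc]

theorem isWalk_singleton (d : A × Bool) : D.IsWalk (D.src d) (D.tgt d) [d] := by
  simp [IsWalk]

theorem IsWalk.reverse {u v : V} {w : List (A × Bool)} (h : D.IsWalk u v w) :
    D.IsWalk v u (w.map oppDart).reverse := by
  induction w generalizing u with
  | nil => exact h.symm
  | cons d l ih =>
    obtain ⟨rfl, h⟩ := h
    rw [List.map_cons, List.reverse_cons, isWalk_append]
    exact ⟨_, ih h, by simp [IsWalk]⟩

/-- A walk from `u` to `v` repeating no vertex. -/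
def IsPath (D : MultiDigraph V A) (u v : V) (w : List (A × Bool)) : Prop :=
  D.IsWalk u v w ∧ (w.map D.src).Nodup ∧ v ∉ w.map D.src

theorem IsPath.tail {u v : V} {d : A × Bool} {w : List (A × Bool)} (h : D.IsPath u v (d :: w)) :
    D.IsPath (D.tgt d) v w := by
  obtain ⟨h₁, h₂, h₃⟩ := h
  simp only [List.map_cons, List.nodup_cons, List.mem_cons, not_or] at h₂ h₃
  exact ⟨h₁.2, h₂.2, h₃.2⟩

theorem IsPath.eq_nil {u : V} {w : List (A × Bool)} (h : D.IsPath u u w) : w = [] := by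
  cases w with
  | nil => rfl
  | cons d w => exact absurd (by simp [h.1.1]) h.2.2

/-- The suffix of a path starting at one of its vertices. -/
theorem IsPath.exists_append {u v x : V} {w : List (A × Bool)} (h : D.IsPath u v w)
    (hx : x ∈ w.map D.src) :
    ∃ l₁ l₂, w = l₁ ++ l₂ ∧ D.IsPath u x l₁ ∧ D.IsPath x v l₂ := by
  obtain ⟨d, hd, rfl⟩ := List.mem_map.1 hx
  obtain ⟨l₁, l₂, rfl⟩ := List.append_of_mem hd
  refine ⟨l₁, d :: l₂, rfl, ?_, ?_⟩
  · obtain ⟨h₁, h₂, -⟩ := h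
    obtain ⟨y, hy, hy'⟩ := isWalk_append.1 h₁
    obtain rfl := hy'.1
    rw [List.map_append, List.nodup_append] at h₂
    exact ⟨hy, h₂.1, fun hm => h₂.2.2 _ hm _ (by simp) rfl⟩
  · obtain ⟨h₁, h₂, h₃⟩ := h
    obtain ⟨y, hy, hy'⟩ := isWalk_append.1 h₁
    obtain rfl := hy'.1
    rw [List.map_append, List.nodup_append] at h₂
    rw [List.map_append, List.mem_append, not_or] at h₃
    exact ⟨hy', h₂.2.1, h₃.2⟩

/-- If a path starts at the end of `d`, avoids the start of `d` except possibly as its last vertex,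
and traverses the arc of `d`, then it does so in its first step. -/
theorem IsPath.eq_cons_oppDart {v : V} {d : A × Bool} {w : List (A × Bool)}
    (h : D.IsPath (D.tgt d) v w) (hd : D.src d ∉ w.map D.src) (ha : d.1 ∈ w.map Prod.fst) :
    ∃ w', w = oppDart d :: w' := by
  obtain ⟨e, he, hed⟩ := List.mem_map.1 ha
  have hne : e ≠ d := fun h => hd (List.mem_map.2 ⟨e, he, by rw [h]⟩)
  have heq : e = oppDart d := by
    rcases e with ⟨a, s⟩
    rcases d with ⟨b, t⟩
    obtain rfl : a = b := hed
    cases s <;> cases t <;> simp_all [oppDart]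
  subst heq
  cases w with
  | nil => simp at he
  | cons e w =>
    rcases List.mem_cons.1 he with rfl | hm
    · exact ⟨w, rfl⟩
    · have h₂ := h.2.1
      rw [List.map_cons, List.nodup_cons] at h₂
      exact absurd (List.mem_map.2 ⟨_, hm, by rw [src_oppDart, h.1.1]⟩) h₂.1

/-- A repeated arc would have to be retraced at once, by `eq_cons_oppDart`, which brings the path
back to a vertex already used. -/
theorem IsPath.nodup_fst {u v : V} {w : List (A × Bool)} (h : D.IsPath u v w) :
    (w.map Prod.fst).Nodup := by
  induction w generalizing u with
  | nil => simp
  | cons d w ih =>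
    rw [List.map_cons, List.nodup_cons]
    refine ⟨fun ha => ?_, ih h.tail⟩
    obtain ⟨h₁, h₂, h₃⟩ := h
    rw [List.map_cons, List.nodup_cons] at h₂
    obtain ⟨w', rfl⟩ := IsPath.eq_cons_oppDart ⟨h₁.2, h₂.2, fun hv => h₃ (by simp_all)⟩ h₂.1 ha
    have h₄ := h₁.2.2
    rw [tgt_oppDart] at h₄
    cases w' with
    | nil => exact h₃ (by simp [show D.src d = v from h₄])
    | cons e w' => exact h₂.1 (by simp [h₄.1])

theorem exists_isWalk_of_eqvGen {u v : V}
    (h : Relation.EqvGen (fun u v : V => ∃ a, D.tail a = u ∧ D.head a = v) u v) :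
    ∃ w, D.IsWalk u v w := by
  induction h with
  | rel u v h =>
    obtain ⟨a, rfl, rfl⟩ := h
    exact ⟨_, isWalk_singleton (a, true)⟩
  | refl u => exact ⟨[], rfl⟩
  | symm u v _ ih => exact ih.elim fun w hw => ⟨_, hw.reverse⟩
  | trans u v x _ _ ih₁ ih₂ =>
    obtain ⟨w₁, h₁⟩ := ih₁
    obtain ⟨w₂, h₂⟩ := ih₂
    exact ⟨w₁ ++ w₂, isWalk_append.2 ⟨v, h₁, h₂⟩⟩

end MultiDigraph

/-! ### Multipliers and the vertex scaling -/

namespace ArcParamDigraph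

open MultiDigraph

variable {V A : Type*} {D : ArcParamDigraph V A}

theorem multiplier_cons (d : A × Bool) (w : List (A × Bool)) :
    D.multiplier (d :: w) = D.multiplier [d] * D.multiplier w := by
  simp [multiplier]

theorem multiplier_append (w₁ w₂ : List (A × Bool)) :
    D.multiplier (w₁ ++ w₂) = D.multiplier w₁ * D.multiplier w₂ := by
  simp [multiplier]

theorem multiplier_oppDart (d : A × Bool) :
    D.multiplier [oppDart d] = (D.multiplier [d])⁻¹ := by
  rcases d with ⟨a, _ | _⟩ <;> simp [multiplier, oppDart]

theorem multiplier_reverse (w : List (A × Bool)) :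
    D.multiplier (w.map oppDart).reverse = (D.multiplier w)⁻¹ := by
  induction w with
  | nil => simp [multiplier]
  | cons d w ih =>
    rw [List.map_cons, List.reverse_cons, multiplier_append, ih, multiplier_oppDart,
      multiplier_cons d w, mul_inv, mul_comm]

theorem Breakeven.lam_pos (hD : D.Breakeven) (a : A) : 0 < D.lam a := by
  refine (D.lam_nonneg a).lt_of_ne' fun h => ?_
  have := hD [(a, true)] ⟨by simp, ⟨D.tail a, rfl, (D.loop_of_lam_eq_zero a h).symm⟩,
    by simp, by simp⟩
  simp [multiplier, h] at this

theorem Breakeven.multiplier_pos (hD : D.Breakeven) (w : List (A × Bool)) :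
    0 < D.multiplier w := by
  refine List.prod_pos fun x hx => ?_
  obtain ⟨⟨a, s⟩, -, rfl⟩ := List.mem_map.1 hx
  cases s <;> simp [hD.lam_pos a]

/-- The closed walk is either a genuine cycle or a dart followed by its reverse; the latter is not
an `IsCycle`, but its factors cancel. -/
theorem Breakeven.multiplier_cons_eq_one (hD : D.Breakeven) {d : A × Bool}
    {w : List (A × Bool)} (h : D.IsPath (D.tgt d) (D.src d) w) : D.multiplier (d :: w) = 1 := by
  by_cases ha : d.1 ∈ w.map Prod.fst
  · obtain ⟨w', rfl⟩ := h.eq_cons_oppDart h.2.2 ha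
    have h' := h.tail
    rw [tgt_oppDart] at h'
    rw [h'.eq_nil, multiplier_cons, multiplier_oppDart,
      mul_inv_cancel₀ (hD.multiplier_pos [d]).ne']
  · exact hD _ ⟨by simp, ⟨D.src d, rfl, h.1⟩, by simpa using ⟨by simpa using h.2.2, h.2.1⟩,
      List.nodup_cons.2 ⟨ha, h.nodup_fst⟩⟩

/-- Loop erasure: each excised piece is a dart closed up by a path, hence has multiplier 1. -/
theorem Breakeven.exists_isPath (hD : D.Breakeven) {u v : V} {w : List (A × Bool)}
    (h : D.IsWalk u v w) : ∃ w', D.IsPath u v w' ∧ D.multiplier w' = D.multiplier w := by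
  induction w generalizing u with
  | nil => exact ⟨[], ⟨h, by simp, by simp⟩, rfl⟩
  | cons d w ih =>
    obtain ⟨rfl, h⟩ := h
    obtain ⟨p, hp, hm⟩ := ih h
    by_cases hu : D.src d ∈ p.map D.src
    · obtain ⟨l₁, l₂, rfl, h₁, h₂⟩ := hp.exists_append hu
      refine ⟨l₂, h₂, ?_⟩
      rw [multiplier_cons, ← hm, multiplier_append, ← mul_assoc, ← multiplier_cons,
        hD.multiplier_cons_eq_one h₁, one_mul]
    · by_cases hv : v = D.src d
      · subst hv
        refine ⟨[], ⟨rfl, by simp, by simp⟩, ?_⟩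
        rw [multiplier_cons, ← hm, ← multiplier_cons, hD.multiplier_cons_eq_one hp]
        simp [multiplier]
      · refine ⟨d :: p, ⟨⟨rfl, hp.1⟩, List.nodup_cons.2 ⟨hu, hp.2.1⟩, ?_⟩, ?_⟩
        · rw [List.map_cons, List.mem_cons, not_or]
          exact ⟨hv, hp.2.2⟩
        · rw [multiplier_cons, hm, ← multiplier_cons]

theorem Breakeven.multiplier_eq_one (hD : D.Breakeven) {u : V} {w : List (A × Bool)}
    (h : D.IsWalk u u w) : D.multiplier w = 1 := by
  obtain ⟨p, hp, hm⟩ := hD.exists_isPath h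
  rw [← hm, hp.eq_nil]
  simp [multiplier]

/-- The arc parameters of a breakeven digraph are the quotients of a positive vertex function. -/
theorem Breakeven.exists_vertex_scaling (hD : D.Breakeven) :
    ∃ π : V → ℝ, (∀ v, 0 < π v) ∧ ∀ a, π (D.head a) = D.lam a * π (D.tail a) := by
  -- `Quot.out` chooses a root in each component; `π v` is the multiplier of a walk from the root to
  -- `v`.
  have hroot : ∀ v : V, ∃ w,
      D.IsWalk (Quot.mk (fun u v : V => ∃ a, D.tail a = u ∧ D.head a = v) v).out v w := fun v =>
    exists_isWalk_of_eqvGen (Quot.eqvGen_exact (Quot.out_eq _))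
  choose w hw using hroot
  refine ⟨fun v => D.multiplier (w v), fun v => hD.multiplier_pos _, fun a => ?_⟩
  have hh := hw (D.head a)
  rw [← Quot.sound (r := fun u v : V => ∃ a, D.tail a = u ∧ D.head a = v) ⟨a, rfl, rfl⟩] at hh
  -- Closed walk from the root to the tail, along `a`, and back from the head.
  have hc := hD.multiplier_eq_one (isWalk_append.2
    ⟨_, isWalk_append.2 ⟨_, hw (D.tail a), isWalk_singleton (a, true)⟩, hh.reverse⟩)
  rw [multiplier_append, multiplier_append, multiplier_reverse,
    mul_inv_eq_one₀ (hD.multiplier_pos _).ne'] at hc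
  change D.multiplier _ = _ * D.multiplier _
  rw [← hc, mul_comm]
  simp [multiplier]

end ArcParamDigraph

theorem ArcParamDigraph.mulVec_transpose {V A : Type*} [Fintype V] (D : ArcParamDigraph V A)
    (p : V → ℝ) (a : A) :
    (D.networkMatrixᵀ *ᵥ p) a = p (D.head a) - D.lam a * p (D.tail a) := by
  classical
  simp [mulVec, dotProduct, networkMatrix, sub_mul, Finset.sum_sub_distrib]

/-! ### Rank and nullity of the ordinary network matrix -/

namespace MultiDigraph

variable {V A : Type*} (G : MultiDigraph V A)

/-- The arc-parameterized digraph with all arc parameters equal to one. -/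
def unitParam : ArcParamDigraph V A where
  toMultiDigraph := G
  lam _ := 1
  lam_nonneg _ := zero_le_one
  loop_of_lam_eq_zero _ h := absurd h one_ne_zero

theorem mulVec_transpose_unitParam [Fintype V] (p : V → ℝ) (a : A) :
    (G.unitParam.networkMatrixᵀ *ᵥ p) a = p (G.head a) - p (G.tail a) := by
  rw [ArcParamDigraph.mulVec_transpose]
  exact congrArg (_ - ·) (one_mul _)

open Classical in
theorem networkMatrix_unitParam (v : V) (a : A) :
    G.unitParam.networkMatrix v a =
      (if v = G.head a then 1 else 0) - (if v = G.tail a then 1 else 0) :=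
  congrArg (_ - ·) (one_mul _)

theorem eq_of_mk_eq {p : V → ℝ} (hp : ∀ a, p (G.head a) = p (G.tail a)) {u v : V}
    (h : (Quot.mk _ u : G.Component) = Quot.mk _ v) : p u = p v := by
  have := Quot.eqvGen_exact h
  clear h
  induction this with
  | rel u v h => obtain ⟨a, rfl, rfl⟩ := h; exact (hp a).symm
  | refl => rfl
  | symm _ _ _ ih => exact ih.symm
  | trans _ _ _ _ _ ih₁ ih₂ => exact ih₁.trans ih₂

instance [Finite V] : Finite G.Component := inferInstanceAs (Finite (Quot _))

/-- The kernel of the transposed network matrix consists of the functions that are constant on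
components. -/
theorem finrank_ker_transpose_unitParam [Fintype V] [Fintype A] :
    Module.finrank ℝ (LinearMap.ker G.unitParam.networkMatrixᵀ.mulVecLin) =
      Nat.card G.Component := by
  have : Fintype G.Component := Fintype.ofFinite _
  let e : (G.Component → ℝ) →ₗ[ℝ] (V → ℝ) := LinearMap.funLeft ℝ ℝ (Quot.mk _)
  have he : Function.Injective e :=
    LinearMap.funLeft_injective_of_surjective _ _ _ Quot.mk_surjective
  have hr : LinearMap.range e = LinearMap.ker G.unitParam.networkMatrixᵀ.mulVecLin := by
    ext p
    rw [LinearMap.mem_range, LinearMap.mem_ker, mulVecLin_apply]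
    constructor
    · rintro ⟨q, rfl⟩
      ext a
      rw [mulVec_transpose_unitParam]
      have : (Quot.mk _ (G.tail a) : G.Component) = Quot.mk _ (G.head a) :=
        Quot.sound ⟨a, rfl, rfl⟩
      exact sub_eq_zero.2 (congrArg q this.symm)
    · intro h
      have h' : ∀ a, p (G.head a) = p (G.tail a) := fun a => by
        have := congrFun h a
        rw [mulVec_transpose_unitParam] at this
        exact sub_eq_zero.1 this
      refine ⟨Quot.lift p ?_, rfl⟩
      rintro u v ⟨a, rfl, rfl⟩
      exact (h' a).symm
  rw [← hr, LinearMap.finrank_range_of_inj he, Module.finrank_fintype_fun_eq_card,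
    Nat.card_eq_fintype_card]

theorem rank_unitParam [Fintype V] [Fintype A] :
    G.unitParam.networkMatrix.rank + Nat.card G.Component = Fintype.card V := by
  rw [← rank_transpose, ← finrank_ker_transpose_unitParam, Matrix.rank,
    LinearMap.finrank_range_add_finrank_ker, Module.finrank_fintype_fun_eq_card]

theorem finrank_ker_unitParam [Fintype V] [Fintype A] :
    Module.finrank ℝ (LinearMap.ker G.unitParam.networkMatrix.mulVecLin) + Fintype.card V =
      Fintype.card A + Nat.card G.Component := by
  have h := LinearMap.finrank_range_add_finrank_ker G.unitParam.networkMatrix.mulVecLin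
  rw [Module.finrank_fintype_fun_eq_card] at h
  have h' := G.rank_unitParam
  rw [Matrix.rank] at h'
  omega

end MultiDigraph

/-! ### Reduction to ordinary circulations -/

namespace ArcParamDigraph

/-- Scaling rows and columns turns generalized flows into ordinary circulations. -/
theorem isFlow_iff_unitParam {V A : Type*} [Fintype A] (D : ArcParamDigraph V A) {π : V → ℝ}
    (hπ : ∀ v, 0 < π v) (h : ∀ a, π (D.head a) = D.lam a * π (D.tail a)) (f : A → ℝ) :
    D.IsFlow f ↔
      D.toMultiDigraph.unitParam.networkMatrix *ᵥ ((fun a => π (D.head a)) * f) = 0 := by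
  have key : ∀ v, (D.toMultiDigraph.unitParam.networkMatrix *ᵥ ((fun a => π (D.head a)) * f)) v =
      π v * (D.networkMatrix *ᵥ f) v := fun v => by
    simp only [mulVec, dotProduct, Finset.mul_sum, Pi.mul_apply]
    refine Finset.sum_congr rfl fun a _ => ?_
    have := h a
    rw [MultiDigraph.networkMatrix_unitParam, networkMatrix]
    split_ifs with h₁ h₂ h₂
    · rw [← h₁] at this ⊢
      rw [← h₂] at this
      linear_combination -f a * this
    · rw [← h₁]; ring
    · rw [this, ← h₂]; ring
    · ring
  rw [IsFlow, funext_iff, funext_iff]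
  refine forall_congr' fun v => ?_
  rw [key]
  exact (mul_eq_zero_iff_left (hπ v).ne').symm

end ArcParamDigraph

/-! ### Planar duality of circulations and bonds -/

namespace SphereEmbedding

open MultiDigraph

variable {V A F : Type*} [Fintype V] [Fintype A] [Fintype F] {D : MultiDigraph V A}
  (E : SphereEmbedding D F)

/-- Turning counterclockwise moves from the face right of `d` to the face left of it; this drives
the telescoping at a vertex. -/
theorem face_rot (d : A × Bool) : E.face (E.rot d) = E.face (oppDart d) := by
  rw [← E.face_next (oppDart d)]
  simp [oppDart]

theorem nonempty_face (E : SphereEmbedding D F) : Nonempty F := by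
  by_contra hF
  rw [not_nonempty_iff] at hF
  have : IsEmpty A := ⟨fun a => hF.elim (E.face (a, true))⟩
  have : IsEmpty V := ⟨fun v => hF.elim (E.home ⟨v, fun a => this.elim a⟩)⟩
  have := E.euler
  simp only [Fintype.card_eq_zero] at this
  omega

theorem mk_face_oppDart (d : A × Bool) :
    (Quot.mk _ (E.face (oppDart d)) : E.dual.Component) = Quot.mk _ (E.face d) := by
  rcases d with ⟨a, _ | _⟩
  · exact (Quot.sound ⟨a, rfl, rfl⟩ :
      (Quot.mk _ (E.face (a, false)) : E.dual.Component) = Quot.mk _ (E.face (a, true))).symm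
  · exact (Quot.sound ⟨a, rfl, rfl⟩ :
      (Quot.mk _ (E.face (a, false)) : E.dual.Component) = Quot.mk _ (E.face (a, true)))

/-- All faces at a vertex lie in one component of the dual. -/
theorem mk_face_eq_of_src_eq {d d' : A × Bool} (h : D.src d = D.src d') :
    (Quot.mk _ (E.face d) : E.dual.Component) = Quot.mk _ (E.face d') := by
  obtain ⟨n, rfl⟩ := (E.rot_sameCycle d d' h).exists_nat_pow_eq
  clear h
  induction n with
  | zero => rfl
  | succ n ih => rw [pow_succ', Equiv.Perm.mul_apply, face_rot, mk_face_oppDart, ih]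

/-- The dual digraph is connected. -/
theorem mk_face_eq_mk (f g : F) : (Quot.mk _ f : E.dual.Component) = Quot.mk _ g := by
  -- `P` says that a face, or every face incident with a vertex, lies in the dual component of `f`;
  -- it is invariant under vertex-face incidence.
  let P : V ⊕ F → Prop := Sum.elim
    (fun v => (∀ d, D.src d = v → (Quot.mk _ (E.face d) : E.dual.Component) = Quot.mk _ f) ∧
      ∀ h, (Quot.mk _ (E.home ⟨v, h⟩) : E.dual.Component) = Quot.mk _ f)
    (fun g => (Quot.mk _ g : E.dual.Component) = Quot.mk _ f)
  have hiso : ∀ d, ¬ D.IsIsolated (D.src d) := by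
    rintro ⟨a, _ | _⟩ h
    · exact (h a).2 rfl
    · exact (h a).1 rfl
  have hP : ∀ x y, Relation.EqvGen (fun x y =>
      (∃ d, x = Sum.inl (D.src d) ∧ y = Sum.inr (E.face d)) ∨
      (∃ v, x = Sum.inl v.1 ∧ y = Sum.inr (E.home v))) x y → (P x ↔ P y) := by
    intro x y h
    induction h with
    | rel x y h =>
      rcases h with ⟨d, rfl, rfl⟩ | ⟨⟨v, hv⟩, rfl, rfl⟩
      · exact ⟨fun h => h.1 d rfl, fun h => ⟨fun d' hd' =>
          (E.mk_face_eq_of_src_eq hd').trans h, fun hi => absurd hi (hiso d)⟩⟩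
      · refine ⟨fun h => h.2 hv, fun h => ⟨?_, fun _ => h⟩⟩
        rintro d rfl
        exact absurd hv (hiso d)
    | refl => rfl
    | symm _ _ _ ih => exact ih.symm
    | trans _ _ _ _ _ ih₁ ih₂ => exact ih₁.trans ih₂
  exact ((hP (Sum.inr f) (Sum.inr g) (E.connected _ _)).1 rfl).symm

theorem card_component_dual : Nat.card E.dual.Component = 1 := by
  obtain ⟨f⟩ := E.nonempty_face
  refine Nat.card_eq_one_iff_exists.2 ⟨Quot.mk _ f, fun x => ?_⟩
  induction x using Quot.ind with
  | _ g => exact E.mk_face_eq_mk g f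

/-- Ordinary bonds of the dual are circulations. -/
theorem mulVec_mulVec_dual (q : F → ℝ) :
    D.unitParam.networkMatrix *ᵥ (E.dual.unitParam.networkMatrixᵀ *ᵥ q) = 0 := by
  classical
  ext v
  let g : A × Bool → ℝ := fun d => if D.src d = v then q (E.face d) else 0
  have h₁ : ∑ d, g (E.rot d) = ∑ d, g d := Equiv.sum_comp E.rot g
  -- The net inflow at `v` is the sum of the changes of `q` from right to left over the darts
  -- leaving `v`; since `rot` permutes the darts, it vanishes.
  have h₂ : (D.unitParam.networkMatrix *ᵥ (E.dual.unitParam.networkMatrixᵀ *ᵥ q)) v =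
      ∑ d, (g (E.rot d) - g d) := by
    rw [Fintype.sum_prod_type]
    simp only [Fintype.sum_bool, mulVec, dotProduct]
    refine Finset.sum_congr rfl fun a _ => ?_
    have := E.dual.mulVec_transpose_unitParam q a
    simp only [mulVec, dotProduct] at this
    rw [this, networkMatrix_unitParam]
    simp only [g, E.src_rot, E.face_rot]
    simp only [dual, oppDart, src, Bool.not_true, Bool.not_false, if_true, Bool.false_eq_true,
      if_false, eq_comm (b := v)]
    split_ifs <;> ring
  rw [h₂, Finset.sum_sub_distrib, h₁, sub_self, Pi.zero_apply]

/-- The dimensions are `|F| - 1` and `|A| - |V| + (number of components)`, equal by Euler's formula.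
-/
theorem range_dual_eq_ker :
    LinearMap.range E.dual.unitParam.networkMatrixᵀ.mulVecLin =
      LinearMap.ker D.unitParam.networkMatrix.mulVecLin := by
  refine Submodule.eq_of_le_of_finrank_eq ?_ ?_
  · rintro _ ⟨q, rfl⟩
    exact E.mulVec_mulVec_dual q
  · have h₁ := E.dual.rank_unitParam
    rw [← rank_transpose, Matrix.rank, card_component_dual] at h₁
    have h₂ := D.finrank_ker_unitParam
    have h₃ := E.euler
    omega

end SphereEmbedding

/-- A bijection transports a distributive lattice structure. -/
theorem Equiv.exists_distribLattice_orderIso {α β : Type*} [DistribLattice α] (e : α ≃ β) :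
    ∃ (_ : DistribLattice β) (f : α ≃o β), ∀ x, f x = e x := by
  let : Max β := ⟨fun x y => e (e.symm x ⊔ e.symm y)⟩
  let : Min β := ⟨fun x y => e (e.symm x ⊓ e.symm y)⟩
  let : LE β := ⟨fun x y => e.symm x ≤ e.symm y⟩
  let : LT β := ⟨fun x y => e.symm x < e.symm y⟩
  let : DistribLattice β := e.symm.injective.distribLattice _ Iff.rfl Iff.rfl
    (fun a b => e.symm_apply_apply _) (fun a b => e.symm_apply_apply _)
  refine ⟨this, ⟨e, fun {a b} => ?_⟩, fun _ => rfl⟩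
  change e.symm (e a) ≤ e.symm (e b) ↔ a ≤ b
  simp

/-- Finitely many linear inequalities, indexed by an arbitrary finite type. -/
theorem exists_fin_mulVec_le {V ι : Type*} [Fintype V] [Fintype ι] (M : Matrix ι V ℝ)
    (b : ι → ℝ) : ∃ (k : ℕ) (M' : Matrix (Fin k) V ℝ) (b' : Fin k → ℝ),
      {p | M *ᵥ p ≤ b} = {p | M' *ᵥ p ≤ b'} := by
  let e := Fintype.equivFin ι
  refine ⟨_, M.submatrix e.symm id, b ∘ e.symm, ?_⟩
  ext p
  exact ⟨fun h i => h (e.symm i), fun h j => by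
    have := h (e j)
    simpa [mulVec, Matrix.submatrix] using this⟩

/-! ### Feasible potentials and bounded bonds -/

namespace MultiDigraph

variable {V A : Type*} [Fintype V] (G : MultiDigraph V A)

theorem mem_potentials_unitParam {c : A → ℝ} {p : V → ℝ} :
    p ∈ G.unitParam.potentials c ↔ ∀ a, p (G.head a) - p (G.tail a) ≤ c a := by
  simp only [ArcParamDigraph.potentials, Set.mem_ofPred_eq, Pi.le_def, mulVec_transpose_unitParam]

theorem isDPolyhedron_potentials_inter [Fintype A] (c : A → ℝ) (I : Set V) :
    IsDPolyhedron (G.unitParam.potentials c ∩ {p | ∀ i ∈ I, p i = 0}) := by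
  classical
  refine ⟨?_, ?_, ?_⟩
  · let M : Matrix (A ⊕ (I ⊕ I)) V ℝ := Matrix.of (Sum.elim G.unitParam.networkMatrixᵀ
      (Sum.elim (fun i => Pi.single i.1 1) (fun i => Pi.single i.1 (-1))))
    obtain ⟨k, M', b, h⟩ := exists_fin_mulVec_le M (Sum.elim c 0)
    refine ⟨k, M', b, h ▸ ?_⟩
    ext p
    have h₁ : ∀ i : I, (M *ᵥ p) (Sum.inr (Sum.inl i)) = p i := fun i => by
      change Pi.single i.1 1 ⬝ᵥ p = p i
      rw [single_dotProduct, one_mul]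
    have h₂ : ∀ i : I, (M *ᵥ p) (Sum.inr (Sum.inr i)) = -p i := fun i => by
      change Pi.single i.1 (-1) ⬝ᵥ p = -p i
      rw [single_dotProduct, neg_one_mul]
    rw [Set.mem_inter_iff, Set.mem_ofPred_eq, Set.mem_ofPred_eq, Pi.le_def, Sum.forall, Sum.forall]
    refine and_congr Iff.rfl ?_
    simp only [h₁, h₂, Sum.elim_inr, Pi.zero_apply, Left.neg_nonpos_iff, ← forall_and,
      ← le_antisymm_iff, Subtype.forall]
  · rintro p ⟨hp, hp'⟩ q ⟨hq, hq'⟩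
    rw [mem_potentials_unitParam] at hp hq
    refine ⟨G.mem_potentials_unitParam.2 fun a => ?_, fun i hi => by simp [hp' i hi, hq' i hi]⟩
    have := hp a
    have := hq a
    simp only [Pi.sup_apply]
    -- The maximum at the head is attained by `p` or `q`, and at the tail it can only exceed that
    -- potential's value.
    rw [sub_le_iff_le_add]
    refine sup_le ?_ ?_
    · linarith [le_sup_left (a := p (G.tail a)) (b := q (G.tail a))]
    · linarith [le_sup_right (a := p (G.tail a)) (b := q (G.tail a))]
  · rintro p ⟨hp, hp'⟩ q ⟨hq, hq'⟩
    rw [mem_potentials_unitParam] at hp hq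
    refine ⟨G.mem_potentials_unitParam.2 fun a => ?_, fun i hi => by simp [hp' i hi, hq' i hi]⟩
    have := hp a
    have := hq a
    simp only [Pi.inf_apply]
    rw [sub_le_comm]
    refine le_inf ?_ ?_
    · linarith [inf_le_left (a := p (G.head a)) (b := q (G.head a))]
    · linarith [inf_le_right (a := p (G.head a)) (b := q (G.head a))]

/-- The bond of a feasible potential that vanishes on `I`. -/
noncomputable def boundedBondOfPotential (c : A → ℝ) (I : Set V)
    (p : ↥(G.unitParam.potentials c ∩ {p | ∀ i ∈ I, p i = 0})) : G.unitParam.BoundedBond c :=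
  ⟨G.unitParam.networkMatrixᵀ *ᵥ p.val, ⟨p.val, rfl⟩, p.2.1⟩

/-- Over a connected digraph, potentials vanishing at a fixed vertex correspond to bonds. -/
theorem bijective_boundedBondOfPotential {v : V}
    (hG : ∀ u : V, (Quot.mk _ u : G.Component) = Quot.mk _ v) (c : A → ℝ) :
    Function.Bijective (G.boundedBondOfPotential c {v}) := by
  constructor
  · rintro ⟨p, hp, hp'⟩ ⟨q, hq, hq'⟩ h
    have h' := congrArg Subtype.val h
    have hpv : p v = 0 := hp' v rfl
    have hqv : q v = 0 := hq' v rfl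
    refine Subtype.ext (funext fun u => ?_)
    -- Equal bonds make `p - q` constant on the single component, and it is 0 at `v`.
    have := G.eq_of_mk_eq (p := p - q) (fun a => by
      have : (G.unitParam.networkMatrixᵀ *ᵥ p) a = (G.unitParam.networkMatrixᵀ *ᵥ q) a :=
        congrFun h' a
      simp only [mulVec_transpose_unitParam] at this
      simp only [Pi.sub_apply]
      linarith) (hG u)
    simp only [Pi.sub_apply] at this
    change p u = q u
    linarith
  · rintro ⟨_, ⟨p, rfl⟩, hp⟩
    have h : G.unitParam.networkMatrixᵀ *ᵥ (fun u => p u - p v) =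
        G.unitParam.networkMatrixᵀ *ᵥ p := by
      ext a
      simp only [mulVec_transpose_unitParam]
      ring
    refine ⟨⟨fun u => p u - p v, ?_, ?_⟩, Subtype.ext h⟩
    · change G.unitParam.networkMatrixᵀ *ᵥ (fun u => p u - p v) ≤ c
      rw [h]
      exact hp
    · rintro i rfl
      exact sub_self _

end MultiDigraph

/-! ### Assembly of the scaling, the duality and the lattices -/

theorem corollary1 {V A F : Type*} [Fintype V] [Fintype A] [Fintype F]
    (D : ArcParamDigraph V A) (hD : D.Breakeven)
    (E : SphereEmbedding D.toMultiDigraph F) :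
    ∃ (Dst : ArcParamDigraph F A) (σ : A → ℝ),
      Dst.toMultiDigraph = E.dual ∧ (∀ a, 0 < σ a) ∧
      (∀ f : A → ℝ, D.IsFlow f ↔ Dst.IsBond (σ * f)) ∧
      ∀ c : A → ℝ, ∃ (I : Set F) (P : Set (F → ℝ)),
        P = Dst.potentials (σ * c) ∩ {p | ∀ i ∈ I, p i = 0} ∧
        IsDPolyhedron P ∧
        ∃ (_ : DistribLattice (D.BoundedFlow c)) (_ : DistribLattice (Dst.BoundedBond (σ * c)))
          (e : P ≃o Dst.BoundedBond (σ * c))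
          (s : D.BoundedFlow c ≃o Dst.BoundedBond (σ * c)),
          (∀ p : P, (e p).val = Dst.networkMatrixᵀ *ᵥ p.val) ∧
          (∀ f : D.BoundedFlow c, (s f).val = σ * f.val) := by
  obtain ⟨π, hπ, hlam⟩ := hD.exists_vertex_scaling
  let σ : A → ℝ := fun a => π (D.head a)
  have hσ : ∀ a, 0 < σ a := fun a => hπ _
  have hflow : ∀ f : A → ℝ, D.IsFlow f ↔ E.dual.unitParam.IsBond (σ * f) := fun f => by
    rw [D.isFlow_iff_unitParam hπ hlam]
    exact (SetLike.ext_iff.1 E.range_dual_eq_ker (σ * f)).symm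
  refine ⟨E.dual.unitParam, σ, rfl, hσ, hflow, fun c => ?_⟩
  obtain ⟨o⟩ := E.nonempty_face
  have hP := E.dual.isDPolyhedron_potentials_inter (σ * c) {o}
  refine ⟨{o}, _, rfl, hP, ?_⟩
  let _ : DistribLattice
      ↥(E.dual.unitParam.potentials (σ * c) ∩ {p | ∀ i ∈ ({o} : Set F), p i = 0}) :=
    Subtype.distribLattice (fun _ _ ha hb => hP.2.1 ha hb) (fun _ _ ha hb => hP.2.2 ha hb)
  obtain ⟨_, e, he⟩ := (Equiv.ofBijective _ (E.dual.bijective_boundedBondOfPotential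
    (fun f => E.mk_face_eq_mk f o) (σ * c))).exists_distribLattice_orderIso
  have hle : ∀ {f g : A → ℝ}, σ * f ≤ σ * g ↔ f ≤ g := fun {f g} =>
    forall_congr' fun a => mul_le_mul_iff_right₀ (hσ a)
  let s : D.BoundedFlow c ≃ E.dual.unitParam.BoundedBond (σ * c) :=
    Equiv.ofBijective (fun f => ⟨σ * f.val, (hflow _).1 f.2.1, hle.2 f.2.2⟩) <| by
      have hinv : ∀ x : A → ℝ, σ * (σ⁻¹ * x) = x := fun x =>
        funext fun a => mul_inv_cancel_left₀ (hσ a).ne' (x a)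
      refine ⟨fun f g h => Subtype.ext ?_, fun x => ?_⟩
      · have h' : σ * f.val = σ * g.val := congrArg Subtype.val h
        exact le_antisymm (hle.1 h'.le) (hle.1 h'.ge)
      · refine ⟨⟨σ⁻¹ * x.val, (hflow _).2 ?_, hle.1 ?_⟩, Subtype.ext (hinv _)⟩
        · rw [hinv]; exact x.2.1
        · rw [hinv]; exact x.2.2
  -- The order on flows is pulled back from bonds, so the transport runs along `s.symm`.
  obtain ⟨_, s', hs'⟩ := s.symm.exists_distribLattice_orderIso
  refine ⟨_, _, e, s'.symm, fun p => congrArg Subtype.val (he p), fun f => ?_⟩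
  have : s'.symm f = s f := by rw [OrderIso.symm_apply_eq, hs', Equiv.symm_apply_apply]
  rw [this]
  rfl
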